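/- Let $\mathbb{K}$ be a field, $\Gamma$ a totally ordered abelian group, $\nu_0:\mathbb{K}\to\Gamma\cup\{\infty\}$ a valuation, and $\nu:\mathbb{K}[x]\to\Gamma\cup\{\infty\}$ a valuation extending $\nu_0$ (a valuation satisfies $\nu(fg)=\nu(f)+\nu(g)$, $\nu(f+g)\ge\min\{\nu(f),\nu(g)\}$, $\nu(1)=0$, $\nu(0)=\infty$; it may take the value $\infty$ on nonzero elements). Call a valuation $\mu$ on $\mathbb{K}[x]$ *Krull* if $\mu(f)=\infty$ only for $f=0$; in that case it extends to $\mathbb{K}(x)$ by $\mu(f/g)=\mu(f)-\mu(g)$, and $\mathbb{K}(x)\mu$ denotes its residue field. Write $\mathbb{K}\nu_0$ for the residue field of $\nu_0$, and $\mu(\mathbb{K}[x])$, $\nu_0\mathbb{K}$ for the value groups, i.e. the subgroups of $\Gamma$ generated by the finite values. A valuation $\mu$ on $\mathbb{K}[x]$ extending $\nu_0$ is *value-transcendental* if it is not Krull or $\mu(\mathbb{K}[x])/\nu_0\mathbb{K}$ is not a torsion group; it is *residue-transcendental* if it is Krull and the field extension $\mathbb{K}(x)\mu\mid\mathbb{K}\nu_0$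 is transcendental; it is *valuation-algebraic* if it is neither value-transcendental nor residue-transcendental. For a non-constant polynomial $q\in\mathbb{K}[x]$, every $f\in\mathbb{K}[x]$ has a unique $q$-expansion $f=f_0+f_1q+\dots+f_sq^s$ with $\deg f_i<\deg q$ for all $i$; the *truncation* of $\nu$ at $q$ is the map $\nu_q(f)=\min_{0\le i\le s}\nu(f_iq^i)$. Suppose that $\nu$ is valuation-algebraic and that $q\in\mathbb{K}[x]$ is a non-constant polynomial such that $\nu_q$ is a valuation on $\mathbb{K}[x]$. Then $\nu_q$ is a valuation extending $\nu_0$ which is residue-transcendental. -/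

import Mathlib

open Polynomial

namespace PolyVal

section ValueGroup

variable {R : Type*} [CommRing R]
variable {Γ : Type*} [AddCommGroup Γ] [LinearOrder Γ] [IsOrderedAddMonoid Γ]

/-- A valuation is Krull if its support `{a | v a = ∞}` is `{0}`. -/
def IsKrull (v : AddValuation R (WithTop Γ)) : Prop :=
  v.supp = ⊥

/-- The value group: the subgroup of `Γ` generated by the finite values of `v`. -/
def valueGroup (v : AddValuation R (WithTop Γ)) : AddSubgroup Γ :=
  AddSubgroup.closure {γ : Γ | ∃ a : R, v a = (γ : WithTop Γ)}

end ValueGroup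

section Truncation

variable {K : Type*} [Field K]

/-- The coefficients `f₀, f₁, …` of the `q`-expansion `f = f₀ + f₁ q + f₂ q² + …`, by iterated
division with remainder. They vanish beyond the index `f.natDegree` if `q` is non-constant;
see `qCoeff_unique` for the characterization. -/
noncomputable def qCoeff (q : K[X]) : K[X] → ℕ → K[X]
  | f, 0 => f % q
  | f, i + 1 => qCoeff q (f / q) i

theorem degree_qCoeff_lt (q : K[X]) (hq : 0 < q.natDegree) (f : K[X]) (i : ℕ) :
    (qCoeff q f i).degree < q.degree := by
  have hq0 : q ≠ 0 := by rintro rfl; simp at hq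
  induction i generalizing f with
  | zero => exact EuclideanDomain.mod_lt f hq0
  | succ i ih => exact ih (f / q)

theorem sum_qCoeff_aux (q : K[X]) (hq : 0 < q.natDegree) (n : ℕ) (f : K[X])
    (hf : f.natDegree ≤ n) :
    f = ∑ i ∈ Finset.range (n + 1), qCoeff q f i * q ^ i := by
  induction n generalizing f with
  | zero =>
    have hlt : f.degree < q.degree := Polynomial.degree_lt_degree (by omega)
    have hq0 : q ≠ 0 := by rintro rfl; simp at hq
    simp [qCoeff, (Polynomial.mod_eq_self_iff hq0).2 hlt]
  | succ n ih =>
    have hd : (f / q).natDegree ≤ n := by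
      rcases eq_or_ne f 0 with rfl | hf0
      · simp
      by_cases hz : f / q = 0
      · simp [hz]
      have := Polynomial.natDegree_lt_natDegree hz
        (Polynomial.degree_div_lt hf0 (Polynomial.natDegree_pos_iff_degree_pos.1 hq))
      omega
    rw [Finset.sum_range_succ']
    have h := ih (f / q) hd
    calc f = q * (f / q) + f % q := (EuclideanDomain.div_add_mod f q).symm
      _ = q * (∑ i ∈ Finset.range (n + 1), qCoeff q (f / q) i * q ^ i) + f % q := by rw [← h]
      _ = _ := by
        rw [Finset.mul_sum]
        simp only [qCoeff, pow_zero, mul_one]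
        congr 1
        exact Finset.sum_congr rfl fun i _ => by ring

/-- The `qCoeff q f i` are the coefficients of a `q`-expansion of `f`. -/
theorem sum_qCoeff (q : K[X]) (hq : 0 < q.natDegree) (f : K[X]) :
    f = ∑ i ∈ Finset.range (f.natDegree + 1), qCoeff q f i * q ^ i :=
  sum_qCoeff_aux q hq f.natDegree f le_rfl

/-- Any `q`-expansion of `f` has the coefficients `qCoeff q f i`. -/
theorem qCoeff_unique (q : K[X]) (hq : 0 < q.natDegree) (n : ℕ) (f : K[X]) (c : ℕ → K[X])
    (hc : ∀ i, (c i).degree < q.degree) (hf : f = ∑ i ∈ Finset.range n, c i * q ^ i) (i : ℕ) :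
    qCoeff q f i = if i < n then c i else 0 := by
  have hq0 : q ≠ 0 := by rintro rfl; simp at hq
  induction n generalizing f c i with
  | zero =>
    have h0 : f = 0 := by simpa using hf
    subst h0
    have : ∀ i, qCoeff q 0 i = 0 := by
      intro i
      induction i with
      | zero => simp [qCoeff]
      | succ i ih => simpa [qCoeff] using ih
    simpa using this i
  | succ n ih =>
    have hf' : f = c 0 + q * ∑ i ∈ Finset.range n, c (i + 1) * q ^ i := by
      rw [hf, Finset.sum_range_succ', Finset.mul_sum, add_comm]
      simp only [pow_zero, mul_one]
      congr 1
      exact Finset.sum_congr rfl fun i _ => by ring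
    have hm : f % q = c 0 := by
      rw [hf', Polynomial.add_mod, (Polynomial.mod_eq_self_iff hq0).2 (hc 0)]
      simp
    have hd : f / q = ∑ i ∈ Finset.range n, c (i + 1) * q ^ i := by
      have h1 := EuclideanDomain.div_add_mod f q
      rw [hm] at h1
      have h2 : q * (f / q) = q * ∑ i ∈ Finset.range n, c (i + 1) * q ^ i := by
        linear_combination h1 + hf'
      exact mul_left_cancel₀ hq0 h2
    cases i with
    | zero => simpa [qCoeff] using hm
    | succ i =>
      have := ih (f / q) (fun i => c (i + 1)) (fun i => hc (i + 1)) hd i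
      simpa [qCoeff] using this

variable {Γ : Type*} [AddCommGroup Γ] [LinearOrder Γ] [IsOrderedAddMonoid Γ]

/-- The truncation `f ↦ min_i ν(f_i q^i)` of `ν` at `q`, over the coefficients `f_i` of the
`q`-expansion of `f` (the vanishing coefficients contribute the value `∞`). It is only a map, in
general not a valuation. -/
noncomputable def truncation (ν : AddValuation K[X] (WithTop Γ)) (q f : K[X]) : WithTop Γ :=
  (Finset.range (f.natDegree + 1)).inf fun i => ν (qCoeff q f i * q ^ i)

end Truncation

section Transcendental

variable {K : Type*} [Field K]
variable {Γ : Type*} [AddCommGroup Γ] [LinearOrder Γ] [IsOrderedAddMonoid Γ]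

/-- `ν` on `K[x]` extends `ν₀` on `K`. -/
def Extends (ν₀ : AddValuation K (WithTop Γ)) (ν : AddValuation K[X] (WithTop Γ)) : Prop :=
  ∀ a : K, ν (C a) = ν₀ a

theorem IsKrull.nonZeroDivisors_le {ν : AddValuation K[X] (WithTop Γ)} (h : IsKrull ν) :
    nonZeroDivisors K[X] ≤ (AddValuation.toValuation ν).supp.primeCompl := by
  intro f hf hmem
  have h1 : f ∈ ν.supp := hmem
  rw [h, Ideal.mem_bot] at h1
  exact nonZeroDivisors.ne_zero hf h1

/-- The extension of a Krull valuation `ν` from `K[x]` to `K(x)`, `ν(f/g) = ν(f) - ν(g)`, in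
Mathlib's multiplicative convention (the order is reversed). -/
noncomputable def toRatFunc (ν : AddValuation K[X] (WithTop Γ)) (h : IsKrull ν) :
    Valuation (RatFunc K) (Multiplicative (WithTop Γ)ᵒᵈ) :=
  (AddValuation.toValuation ν).extendToLocalization h.nonZeroDivisors_le (RatFunc K)

theorem Extends.hasExtension {ν₀ : AddValuation K (WithTop Γ)}
    {ν : AddValuation K[X] (WithTop Γ)} (hext : Extends ν₀ ν) (h : IsKrull ν) :
    (AddValuation.toValuation ν₀).HasExtension (toRatFunc ν h) where
  val_isEquiv_comap := by
    apply Valuation.IsEquiv.of_eq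
    ext a
    rw [Valuation.comap_apply, IsScalarTower.algebraMap_apply K K[X] (RatFunc K), toRatFunc,
      Valuation.extendToLocalization_apply_map_apply]
    exact congrArg (fun z : WithTop Γ => Multiplicative.ofAdd (OrderDual.toDual z)) (hext a).symm

/-- The residue field `Kν₀`. -/
abbrev ResidueBase (ν₀ : AddValuation K (WithTop Γ)) : Type _ :=
  IsLocalRing.ResidueField (AddValuation.toValuation ν₀).valuationSubring

/-- The residue field `K(x)ν` of a Krull valuation on `K[x]`. -/
abbrev ResidueRatFunc (ν : AddValuation K[X] (WithTop Γ)) (h : IsKrull ν) : Type _ :=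
  IsLocalRing.ResidueField (toRatFunc ν h).valuationSubring

/-- `ν` extends `ν₀`, and is not Krull or has a value group that is not torsion over that
of `ν₀`. -/
def IsValueTranscendental (ν₀ : AddValuation K (WithTop Γ))
    (ν : AddValuation K[X] (WithTop Γ)) : Prop :=
  Extends ν₀ ν ∧
    (¬ IsKrull ν ∨
      ¬ IsAddTorsion (valueGroup ν ⧸ (valueGroup ν₀).addSubgroupOf (valueGroup ν)))

/-- `ν` extends `ν₀`, is Krull, and `K(x)ν ∣ Kν₀` is a transcendental field extension. -/
def IsResidueTranscendental (ν₀ : AddValuation K (WithTop Γ))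
    (ν : AddValuation K[X] (WithTop Γ)) : Prop :=
  ∃ (hext : Extends ν₀ ν) (h : IsKrull ν),
    haveI := hext.hasExtension h
    Algebra.Transcendental (ResidueBase ν₀) (ResidueRatFunc ν h)

def IsValuationTranscendental (ν₀ : AddValuation K (WithTop Γ))
    (ν : AddValuation K[X] (WithTop Γ)) : Prop :=
  IsValueTranscendental ν₀ ν ∨ IsResidueTranscendental ν₀ ν

def IsValuationAlgebraic (ν₀ : AddValuation K (WithTop Γ))
    (ν : AddValuation K[X] (WithTop Γ)) : Prop :=
  Extends ν₀ ν ∧ ¬ IsValuationTranscendental ν₀ ν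

end Transcendental

end PolyVal

namespace PolyVal

section Auxiliary

variable {K : Type*} [Field K]

/-! Since `ν` is Krull with torsion quotient of value groups, some `g = a q^e` with `a` a nonzero
constant and `e > 0` has value `0` (`exists_map_C_mul_pow_eq_zero`). The `q`-expansion of `P(g)` has
constant coefficients `Pᵢ aⁱ`, placed at the exponents `ie`, so no cancellation can raise
`ν_q(P(g))` above any `ν₀(Pᵢ)` (`truncation_comp_mul_pow_le`). A polynomial over the valuation ring
with nonzero reduction has a unit coefficient, so its value at `g` is a unit and its reduction does
not vanish at the residue of `g` (`transcendental_residue`). -/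

/-- The `q`-expansion of `P(q)` has the coefficients of `P`. -/
theorem qCoeff_comp (q : K[X]) (hq : 0 < q.natDegree) (P : K[X]) (i : ℕ) :
    qCoeff q (P.comp q) i = C (P.coeff i) := by
  rw [qCoeff_unique q hq (P.natDegree + 1) (P.comp q) (fun i => C (P.coeff i))
    (fun i => degree_C_le.trans_lt (natDegree_pos_iff_degree_pos.1 hq))
    (by rw [comp, eval₂_eq_sum_range]) i]
  split_ifs with h
  · rfl
  · rw [coeff_eq_zero_of_natDegree_lt (by omega), C_0]

variable {Γ : Type*} [AddCommGroup Γ] [LinearOrder Γ] [IsOrderedAddMonoid Γ]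

theorem Extends.truncation {ν₀ : AddValuation K (WithTop Γ)}
    {ν νq : AddValuation K[X] (WithTop Γ)} (hext : Extends ν₀ ν) {q : K[X]}
    (hq : 0 < q.natDegree) (hνq : ∀ f : K[X], νq f = truncation ν q f) : Extends ν₀ νq := by
  intro a
  have h := qCoeff_comp q hq (C a) 0
  rw [C_comp, coeff_C_zero] at h
  simp [hνq, PolyVal.truncation, h, hext a]

/-- A minimum equal to `∞` forces every term of the `q`-expansion into the support of `ν`, which is
zero. -/
theorem IsKrull.truncation {ν νq : AddValuation K[X] (WithTop Γ)} (hν : IsKrull ν) {q : K[X]}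
    (hq : 0 < q.natDegree) (hνq : ∀ f : K[X], νq f = truncation ν q f) : IsKrull νq := by
  refine (Submodule.eq_bot_iff _).2 fun f hf => ?_
  have hf' := (AddValuation.mem_supp_iff νq f).1 hf
  rw [hνq, PolyVal.truncation, Finset.inf_eq_top_iff] at hf'
  rw [sum_qCoeff q hq f]
  refine Finset.sum_eq_zero fun i hi => ?_
  have h : qCoeff q f i * q ^ i ∈ ν.supp := (AddValuation.mem_supp_iff _ _).2 (hf' i hi)
  rwa [hν, Ideal.mem_bot] at h

/-- `ν_q(P(q)) ≤ ν(Pᵢ qⁱ)` for every nonzero coefficient `Pᵢ`. -/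
theorem truncation_comp_le (ν : AddValuation K[X] (WithTop Γ)) {q : K[X]} (hq : 0 < q.natDegree)
    (P : K[X]) {i : ℕ} (hi : P.coeff i ≠ 0) :
    truncation ν q (P.comp q) ≤ ν (C (P.coeff i) * q ^ i) := by
  rw [← qCoeff_comp q hq P i]
  refine Finset.inf_le (f := fun i => ν (qCoeff q (P.comp q) i * q ^ i)) ?_
  -- The truncation ranges up to `deg P * deg q`, which covers `i ≤ deg P` because `deg q ≥ 1`.
  rw [Finset.mem_range, natDegree_comp]
  exact Nat.lt_succ_of_le ((le_natDegree_of_ne_zero hi).trans (Nat.le_mul_of_pos_right _ hq))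

/-- If `a qᵉ` has value `0`, then `ν_q(P(a qᵉ)) ≤ ν₀(Pᵢ)` for all `i`. -/
theorem truncation_comp_mul_pow_le {ν₀ : AddValuation K (WithTop Γ)}
    {ν : AddValuation K[X] (WithTop Γ)} (hext : Extends ν₀ ν) {q : K[X]} (hq : 0 < q.natDegree)
    {a : K} (ha : a ≠ 0) {e : ℕ} (he : 0 < e) (hae : ν (C a * q ^ e) = 0) (P : K[X]) (i : ℕ) :
    truncation ν q (P.comp (C a * q ^ e)) ≤ ν₀ (P.coeff i) := by
  rcases eq_or_ne (P.coeff i) 0 with hi | hi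
  · simp [hi]
  -- Rewritten as a polynomial in `q` itself, so that its coefficients are the `q`-coefficients.
  have hc : P.comp (C a * q ^ e) = (expand K e (P.comp (C a * X))).comp q := by
    rw [expand_eq_comp_X_pow, comp_assoc, comp_assoc]
    simp
  have hcoeff : (expand K e (P.comp (C a * X))).coeff (i * e) = P.coeff i * a ^ i := by
    rw [coeff_expand_mul he, comp_C_mul_X_coeff]
  have h := truncation_comp_le ν hq (expand K e (P.comp (C a * X))) (i := i * e)
    (by rw [hcoeff]; exact mul_ne_zero hi (pow_ne_zero _ ha))
  rw [hc]
  refine h.trans_eq ?_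
  rw [hcoeff, show C (P.coeff i * a ^ i) * q ^ (i * e) = C (P.coeff i) * (C a * q ^ e) ^ i by
    rw [mul_pow, ← pow_mul, C_mul, C_pow, mul_comm e i]; ring, AddValuation.map_mul,
    AddValuation.map_pow, hae, smul_zero, add_zero, hext]

/-- Over a field, every element of the value group is a value. -/
theorem exists_eq_of_mem_valueGroup (ν₀ : AddValuation K (WithTop Γ)) {γ : Γ}
    (hγ : γ ∈ valueGroup ν₀) : ∃ a : K, ν₀ a = (γ : WithTop Γ) := by
  induction hγ using AddSubgroup.closure_induction with
  | mem x hx => exact hx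
  | zero => exact ⟨1, AddValuation.map_one ν₀⟩
  | add x y _ _ hx hy =>
    obtain ⟨a, ha⟩ := hx
    obtain ⟨b, hb⟩ := hy
    exact ⟨a * b, by rw [AddValuation.map_mul, ha, hb, WithTop.coe_add]⟩
  | neg x _ hx =>
    obtain ⟨a, ha⟩ := hx
    refine ⟨a⁻¹, ?_⟩
    have ha0 : a ≠ 0 := by
      rintro rfl
      simp at ha
    have h := AddValuation.map_mul ν₀ a⁻¹ a
    rw [inv_mul_cancel₀ ha0, AddValuation.map_one, ha] at h
    cases hb : ν₀ a⁻¹ with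
    | top => simp [hb] at h
    | coe b =>
      rw [hb, ← WithTop.coe_add, ← WithTop.coe_zero, WithTop.coe_inj] at h
      rw [eq_neg_of_add_eq_zero_left h.symm]

/-- If the value groups have torsion quotient, every `q` with finite value has a power with value
`0` up to a constant. -/
theorem exists_map_C_mul_pow_eq_zero {ν₀ : AddValuation K (WithTop Γ)}
    {ν : AddValuation K[X] (WithTop Γ)} (hext : Extends ν₀ ν)
    (htor : IsAddTorsion (valueGroup ν ⧸ (valueGroup ν₀).addSubgroupOf (valueGroup ν)))
    {q : K[X]} (hqv : ν q ≠ ⊤) : ∃ a : K, a ≠ 0 ∧ ∃ e : ℕ, 0 < e ∧ ν (C a * q ^ e) = 0 := by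
  obtain ⟨γ, hγ⟩ := WithTop.ne_top_iff_exists.1 hqv
  let g : valueGroup ν := ⟨γ, AddSubgroup.subset_closure ⟨q, hγ.symm⟩⟩
  obtain ⟨e, he, h⟩ := isOfFinAddOrder_iff_nsmul_eq_zero.1
    (htor (g : valueGroup ν ⧸ (valueGroup ν₀).addSubgroupOf (valueGroup ν)))
  rw [← QuotientAddGroup.mk_nsmul, QuotientAddGroup.eq_zero_iff,
    AddSubgroup.mem_addSubgroupOf] at h
  -- The constant `a` has value `-eγ`, to cancel `ν(q^e) = eγ`.
  obtain ⟨a, ha⟩ := exists_eq_of_mem_valueGroup ν₀ (neg_mem h)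
  refine ⟨a, ?_, e, he, ?_⟩
  · rintro rfl
    rw [AddValuation.map_zero] at ha
    exact WithTop.top_ne_coe ha
  · rw [AddValuation.map_mul, AddValuation.map_pow, hext, ha, ← hγ, ← WithTop.coe_nsmul,
      ← WithTop.coe_add, ← WithTop.coe_zero, WithTop.coe_inj]
    exact neg_add_cancel (e • γ)

/-- If the value of `P(g)` is at most the values of the coefficients of `P`, for all `P`, then
the residue of `g` is transcendental. -/
theorem transcendental_residue {ν₀ : AddValuation K (WithTop Γ)}
    {μ : AddValuation K[X] (WithTop Γ)} (hext : Extends ν₀ μ) (h : IsKrull μ) {g : K[X]}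
    (hg : 0 ≤ μ g) (hle : ∀ (P : K[X]) (i : ℕ), μ (P.comp g) ≤ ν₀ (P.coeff i)) :
    haveI := hext.hasExtension h
    Algebra.Transcendental (ResidueBase ν₀) (ResidueRatFunc μ h) := by
  have := hext.hasExtension h
  have hval (f : K[X]) : toRatFunc μ h (algebraMap K[X] (RatFunc K) f) =
      AddValuation.toValuation μ f :=
    Valuation.extendToLocalization_apply_map_apply ..
  let y : (toRatFunc μ h).valuationSubring := ⟨algebraMap K[X] (RatFunc K) g, by
    rw [Valuation.mem_valuationSubring_iff, hval]
    exact hg⟩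
  refine ⟨IsLocalRing.residue _ y, transcendental_iff.2 fun p hp => ?_⟩
  obtain ⟨p, rfl⟩ := map_surjective _ IsLocalRing.residue_surjective p
  by_contra hne
  obtain ⟨i, hi⟩ : ∃ i, IsLocalRing.residue _ (p.coeff i) ≠ 0 := by
    by_contra! H
    exact hne (ext fun i => by rw [coeff_map, H i, coeff_zero])
  have hres : IsLocalRing.residue _ (aeval y p) = 0 := by
    rw [← hp, aeval_def, aeval_def, hom_eval₂, eval₂_map]
    rfl
  -- Inside `K(x)`, `p(y)` is the polynomial `p(g)`, to which `hle` applies.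
  have hcoe : ((aeval y p : (toRatFunc μ h).valuationSubring) : RatFunc K) =
      algebraMap K[X] (RatFunc K)
        ((p.map (AddValuation.toValuation ν₀).valuationSubring.subtype).comp g) := by
    rw [comp, eval₂_map, hom_eval₂, aeval_def]
    exact hom_eval₂ p _ (toRatFunc μ h).valuationSubring.subtype y
  have hunit : IsUnit (p.coeff i) := by
    by_contra H
    exact hi ((IsLocalRing.residue_eq_zero_iff _).2 ((IsLocalRing.mem_maximalIdeal _).2 H))
  have hnunit : ¬ IsUnit (aeval y p) :=
    (IsLocalRing.mem_maximalIdeal _).1 ((IsLocalRing.residue_eq_zero_iff _).1 hres)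
  have h1 : AddValuation.toValuation ν₀ (p.coeff i : K) = 1 :=
    (Valuation.integer.integers (AddValuation.toValuation ν₀)).one_of_isUnit hunit
  refine hnunit
    ((Valuation.integer.integers (toRatFunc μ h)).isUnit_of_one' (le_antisymm ?_ ?_))
  · exact (aeval y p).2
  -- The multiplicative order is reversed: this says `μ(p(g)) ≤ 0`, where `0` is the value of the
  -- unit coefficient `pᵢ`.
  · change 1 ≤ toRatFunc μ h ((aeval y p : (toRatFunc μ h).valuationSubring) : RatFunc K)
    rw [hcoe, hval, ← h1]
    have h2 := hle (p.map (AddValuation.toValuation ν₀).valuationSubring.subtype) i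
    rw [coeff_map] at h2
    exact h2

end Auxiliary

end PolyVal

theorem mainTheorem10 {K : Type*} [Field K]
    {Γ : Type*} [AddCommGroup Γ] [LinearOrder Γ] [IsOrderedAddMonoid Γ]
    (ν₀ : AddValuation K (WithTop Γ)) (ν : AddValuation K[X] (WithTop Γ))
    (hν : PolyVal.IsValuationAlgebraic ν₀ ν)
    (q : K[X]) (hq : 0 < q.natDegree)
    (νq : AddValuation K[X] (WithTop Γ))
    (hνq : ∀ f : K[X], νq f = PolyVal.truncation ν q f) :
    PolyVal.IsResidueTranscendental ν₀ νq := by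
  obtain ⟨hext, hnt⟩ := hν
  have hK : PolyVal.IsKrull ν := by
    by_contra H
    exact hnt (Or.inl ⟨hext, Or.inl H⟩)
  have htor : IsAddTorsion (PolyVal.valueGroup ν ⧸
      (PolyVal.valueGroup ν₀).addSubgroupOf (PolyVal.valueGroup ν)) := by
    by_contra H
    exact hnt (Or.inl ⟨hext, Or.inr H⟩)
  have hqv : ν q ≠ ⊤ := fun H => by
    have hmem : q ∈ ν.supp := (AddValuation.mem_supp_iff _ _).2 H
    rw [hK, Ideal.mem_bot] at hmem
    simp [hmem] at hq
  obtain ⟨a, ha, e, he, hae⟩ := PolyVal.exists_map_C_mul_pow_eq_zero hext htor hqv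
  -- As `q = X(q)`, its only nonzero `q`-coefficient is `1` at index `1`; the other terms contribute
  -- `∞`.
  have hqq : νq q = ν q := by
    refine le_antisymm ?_ ?_
    · have h := PolyVal.truncation_comp_le ν hq X (i := 1) (by simp)
      simpa [hνq] using h
    · rw [hνq]
      refine Finset.le_inf fun i _ => ?_
      have h := PolyVal.qCoeff_comp q hq X i
      rw [X_comp, coeff_X] at h
      rw [h]
      split_ifs with h1
      · simp [← h1]
      · simp
  have hextq := hext.truncation hq hνq
  refine ⟨hextq, hK.truncation hq hνq,
    PolyVal.transcendental_residue hextq _ (g := C a * q ^ e) ?_ fun P i => ?_⟩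
  -- `ν_q` and `ν` agree on constants and on `q`, hence on `a q^e`.
  · rw [AddValuation.map_mul, AddValuation.map_pow, hqq, hextq, ← hext, ← AddValuation.map_pow,
      ← AddValuation.map_mul, hae]
  · rw [hνq]
    exact PolyVal.truncation_comp_mul_pow_le hext hq ha he hae P i
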